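/- Throughout, Lie algebras are over $\mathbb{C}$. An extended affine Lie algebra is a triple $(E,(\cdot,\cdot),\mathcal H)$, where $E$ is a Lie algebra, $\mathcal H\neq 0$ is a finite-dimensional subalgebra, and $(\cdot,\cdot)$ is a symmetric bilinear form on $E$, such that: - (A1) the form is invariant and non-degenerate; - (A2) $E=\sum_{\alpha\in R}E_\alpha$ with $E_\alpha=\{x\in E: [h,x]=\alpha(h)x \text{ for all } h\in\mathcal H\}$, $R=\{\alpha\in\mathcal H^\star: E_\alpha\neq 0\}$ and $E_0=\mathcal H$. Then the form is non-degenerate on $\mathcal H$, and it induces a form on $\mathcal H^\star$ by $(\alpha,\beta)=(t_\alpha,t_\beta)$, where $\alpha(h)=(h,t_\alpha)$ for $h\in\mathcal H$. Let $R^0$ and $R^\times$ be the sets of roots $\alpha\in R$ with $(\alpha,\alpha)=0$ (isotropic) and $(\alpha,\alpha)\neq0$ (non-isotropic), and let the core $E_c$ be the subalgebra generated by all $E_\alpha$, $\alpha\in R^\times$; - (A3) for $\alpha\in R^\times$ and $x\in E_\alpha$, $\operatorname{ad}x$ is locally nilpotent on $E$; - (A4) the centralizer of $E_c$ in $E$ is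 contained in $E_c$; - (A5) the $\mathbb{Z}$-span of $R$ is a free abelian group of finite rank; - (A6) $R^\times$ is not the union of two disjoint non-empty mutually orthogonal subsets. Let $\mathcal V$ and $\mathcal V^0$ be the real spans of $R$ and $R^0$ in $\mathcal H^\star$. The image of $R$ in $\mathcal V/\mathcal V^0$ is an irreducible finite root system $\bar R$. The rank of $E$ is $\dim_{\mathbb R}\mathcal V/\mathcal V^0$, and $E$ is of simply laced type if all nonzero roots of $\bar R$ have the same length, that is, if $(\alpha,\alpha)=(\beta,\beta)$ for all $\alpha,\beta\in R^\times$. A Cartan automorphism of $E$ is a Lie algebra automorphism $\Psi$ with $\Psi(h)=h$ for all $h\in\mathcal H$. It is diagonal if it acts by a scalar on every root space $E_\alpha$, $\alpha\in R$ (isotropic roots included). A map $\psi:R\to\mathbb{C}^\times$ is associated to $\Psi$ if $\Psi|_{E_\alpha}=\psi(\alpha)\,\mathrm{id}$ for every $\alpha\in R^\times$, and $\psi(\sigma)=\psi(\alpha+\sigma)\psi(-\alpha)$ for all $\sigma\in R^0$ and all $\alpha\in R^\times$ with $\alpha+\sigma\in R^\times$. A map $\psi:R\to\mathbb{C}^\times$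 is a character if $\psi(\alpha+\beta)=\psi(\alpha)\psi(\beta)$ whenever $\alpha,\beta,\alpha+\beta\in R$. **Proposition.** Let $E$ be an extended affine Lie algebra of simply laced type and of rank $>1$, and let $\Psi$ be a Cartan automorphism of $E$ of finite order. Then (i) $\Psi$ is diagonal; (ii) there is exactly one map $\psi:R\to\mathbb{C}^\times$ associated to $\Psi$ (the core-character associated to $\Psi$), and $\psi$ is a character. -/

import Mathlib

noncomputable section

open Module

/-- A complex Lie algebra `E` with an invariant non-degenerate symmetric bilinear form and a
nonzero finite-dimensional splitting Cartan subalgebra `H`: `E` is the sum of the simultaneous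
eigenspaces `E_α = {x | [h, x] = α(h) x for all h ∈ H}`, `α ∈ H*`, and `E_0 = H`. -/
structure SplitLieTriple (E : Type*) [LieRing E] [LieAlgebra ℂ E] where
  /-- the bilinear form `(·,·)` -/
  form : LinearMap.BilinForm ℂ E
  /-- the Cartan subalgebra -/
  H : LieSubalgebra ℂ E
  form_symm : ∀ x y : E, form x y = form y x
  form_invariant : ∀ x y z : E, form ⁅x, y⁆ z = form x ⁅y, z⁆
  form_nondegenerate : ∀ x : E, (∀ y : E, form x y = 0) → x = 0
  H_ne_bot : H ≠ ⊥
  H_finite : FiniteDimensional ℂ H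
  iSup_eigenspaces : (⨆ α : Dual ℂ H, ⨅ h : H,
    End.eigenspace (LieAlgebra.ad ℂ E (h : E)) (α h)) = ⊤
  zero_eigenspace : ∀ x : E, (∀ h ∈ H, ⁅h, x⁆ = 0) ↔ x ∈ H

namespace SplitLieTriple

variable {E : Type*} [LieRing E] [LieAlgebra ℂ E] (T : SplitLieTriple E)

instance : FiniteDimensional ℂ T.H := T.H_finite

/-- The space `E_α = {x | [h, x] = α(h) x for all h ∈ H}`. -/
def rootSpace (α : Dual ℂ T.H) : Submodule ℂ E :=
  ⨅ h : T.H, End.eigenspace (LieAlgebra.ad ℂ E (h : E)) (α h)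

theorem mem_rootSpace {α : Dual ℂ T.H} {x : E} :
    x ∈ T.rootSpace α ↔ ∀ h : T.H, ⁅(h : E), x⁆ = α h • x := by
  simp [rootSpace, Submodule.mem_iInf]

/-- The root system `R = {α ∈ H* | E_α ≠ 0}`. It contains `0`, as `E_0 = H ≠ 0`. -/
def roots : Set (Dual ℂ T.H) := {α | T.rootSpace α ≠ ⊥}

/-- The restriction of the form to `H`. -/
def formH : LinearMap.BilinForm ℂ T.H := T.form.restrict T.H.toSubmodule

theorem formH_apply (h k : T.H) : T.formH h k = T.form (h : E) (k : E) := rfl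

theorem formH_eq_zero {h : T.H} (hh : ∀ k : T.H, T.formH h k = 0) : h = 0 := by
  have habel : ∀ k : T.H, ⁅(h : E), (k : E)⁆ = 0 := fun k =>
    (T.zero_eigenspace (k : E)).2 k.2 h h.2
  have key : ∀ x : E, T.form h x = 0 := by
    intro x
    have hx : x ∈ ⨆ α : Dual ℂ T.H, T.rootSpace α := by
      have := T.iSup_eigenspaces
      unfold rootSpace
      rw [this]
      trivial
    refine Submodule.iSup_induction (T.rootSpace) (motive := fun x => T.form h x = 0) hx ?_ ?_ ?_
    · intro α y hy
      rw [mem_rootSpace] at hy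
      by_cases hα : α = 0
      · have hyH : y ∈ T.H := (T.zero_eigenspace y).1 (fun k hk => by
          have := hy ⟨k, hk⟩
          simpa [hα] using this)
        exact hh ⟨y, hyH⟩
      · obtain ⟨k, hk⟩ : ∃ k, α k ≠ 0 := by
          by_contra hcon
          push Not at hcon
          exact hα (LinearMap.ext hcon)
        have h1 := T.form_invariant h k y
        rw [habel k, hy k] at h1
        simp only [map_zero, LinearMap.zero_apply, map_smul, smul_eq_mul] at h1
        exact (mul_eq_zero.1 h1.symm).resolve_left hk
    · simp
    · intro y z hy hz
      simp [hy, hz]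
  exact Subtype.ext (T.form_nondegenerate h key)

theorem formH_nondegenerate : T.formH.Nondegenerate := by
  refine ⟨fun h hh => T.formH_eq_zero hh, fun h hh => T.formH_eq_zero fun k => ?_⟩
  rw [formH_apply, T.form_symm]
  exact hh k

/-- The element `t_α ∈ H` representing `α ∈ H*` through the form on `H`. -/
def t (α : Dual ℂ T.H) : T.H := (T.formH.toDual T.formH_nondegenerate).symm α

/-- The defining property `α(h) = (h, t_α)`. -/
theorem form_t (α : Dual ℂ T.H) (h : T.H) : T.form (h : E) (T.t α : E) = α h := by
  rw [T.form_symm]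
  exact LinearMap.BilinForm.apply_toDual_symm_apply (hB := T.formH_nondegenerate) α h

/-- The form on `H*`, `(α, β) := (t_α, t_β)`. -/
def dualForm (α β : Dual ℂ T.H) : ℂ := T.form (T.t α : E) (T.t β : E)

/-- The set `R⁰` of isotropic roots. -/
def isotropicRoots : Set (Dual ℂ T.H) := {α | α ∈ T.roots ∧ T.dualForm α α = 0}

/-- The set `R^×` of non-isotropic roots. -/
def nonisotropicRoots : Set (Dual ℂ T.H) := {α | α ∈ T.roots ∧ T.dualForm α α ≠ 0}

/-- The core `E_c`: the subalgebra generated by the non-isotropic root spaces. -/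
def core : LieSubalgebra ℂ E :=
  LieSubalgebra.lieSpan ℂ E (⋃ α ∈ T.nonisotropicRoots, (T.rootSpace α : Set E))

/-- `𝒱`, the real span of the roots in `H*`. -/
def realSpan : Submodule ℝ (Dual ℂ T.H) := Submodule.span ℝ T.roots

/-- `𝒱⁰`, the real span of the isotropic roots in `H*`. -/
def isotropicRealSpan : Submodule ℝ (Dual ℂ T.H) := Submodule.span ℝ T.isotropicRoots

/-- The rank of the root system: the dimension of the quotient space `𝒱 / 𝒱⁰`, which is
spanned by the image of `R` (the finite root system attached to `R`). -/
def rank : ℕ := finrank ℝ (T.realSpan ⧸ T.isotropicRealSpan.submoduleOf T.realSpan)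

/-- `R` is simply laced: there is only one root length, i.e. `(α, α)` takes the same value on all
non-isotropic roots. As `(α, α)` depends only on the image of `α` in `𝒱 / 𝒱⁰`, this says
that all nonzero roots of the finite root system attached to `R` have the same length, i.e. that
this irreducible root system is reduced and of type `A`, `D` or `E`. -/
def IsSimplyLaced : Prop :=
  ∀ α ∈ T.nonisotropicRoots, ∀ β ∈ T.nonisotropicRoots, T.dualForm α α = T.dualForm β β

end SplitLieTriple

/-- Extended affine Lie algebras (tame, over `ℂ`). -/
structure ExtendedAffineLieAlgebra (E : Type*) [LieRing E] [LieAlgebra ℂ E] extends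
    SplitLieTriple E where
  /-- `ad x` is locally nilpotent for `x` in a non-isotropic root space -/
  ad_locally_nilpotent : ∀ α ∈ toSplitLieTriple.nonisotropicRoots,
    ∀ x ∈ toSplitLieTriple.rootSpace α, ∀ y : E, ∃ n : ℕ, ((LieAlgebra.ad ℂ E x) ^ n) y = 0
  /-- `E` is tame: the centralizer of the core is contained in the core -/
  tame : ∀ x : E, (∀ y ∈ toSplitLieTriple.core, ⁅x, y⁆ = 0) → x ∈ toSplitLieTriple.core
  /-- the `ℤ`-span of the roots is a free abelian group ... -/
  rootLattice_free : Module.Free ℤ (Submodule.span ℤ toSplitLieTriple.roots)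
  /-- ... of finite rank -/
  rootLattice_finite : Module.Finite ℤ (Submodule.span ℤ toSplitLieTriple.roots)
  /-- the set of non-isotropic roots is indecomposable -/
  indecomposable : ∀ R₁ R₂ : Set (Dual ℂ toSplitLieTriple.H),
    toSplitLieTriple.nonisotropicRoots = R₁ ∪ R₂ → Disjoint R₁ R₂ → R₁.Nonempty → R₂.Nonempty →
    ∃ α ∈ R₁, ∃ β ∈ R₂, toSplitLieTriple.dualForm α β ≠ 0

namespace SplitLieTriple

variable {E : Type*} [LieRing E] [LieAlgebra ℂ E] (T : SplitLieTriple E)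

/-- A Cartan automorphism: an automorphism of the Lie algebra `E` that fixes `H` pointwise. -/
def IsCartanAut (Ψ : E ≃ₗ⁅ℂ⁆ E) : Prop := ∀ h ∈ T.H, Ψ h = h

/-- `Ψ` acts as a scalar on each root space, including the isotropic ones. -/
def IsDiagonal (Ψ : E ≃ₗ⁅ℂ⁆ E) : Prop :=
  ∀ α ∈ T.roots, ∃ c : ℂ, ∀ x ∈ T.rootSpace α, Ψ x = c • x

/-- A core-character: a map `ψ : R → ℂ^×` with `ψ(α + β) = ψ(α) ψ(β)` for `α ∈ R^×` and
`β, α + β ∈ R`. -/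
def IsCoreCharacter (ψ : T.roots → ℂˣ) : Prop :=
  ∀ α β γ : T.roots, (α : Dual ℂ T.H) ∈ T.nonisotropicRoots →
    (γ : Dual ℂ T.H) = α + β → ψ γ = ψ α * ψ β

/-- A character: a core-character `ψ` with `ψ(α + β) = ψ(α) ψ(β)` for all `α, β, α + β ∈ R`. -/
def IsCharacter (ψ : T.roots → ℂˣ) : Prop :=
  T.IsCoreCharacter ψ ∧
    ∀ α β γ : T.roots, (γ : Dual ℂ T.H) = α + β → ψ γ = ψ α * ψ β

/-- `ψ : R → ℂ^×` is the map associated to the automorphism `Ψ`: for `α ∈ R^×`, `ψ(α)` is the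
scalar by which `Ψ` acts on `E_α`, and for `σ ∈ R⁰`, `ψ(σ) = ψ(α + σ) ψ(-α)` for every
`α ∈ R^×` with `α + σ ∈ R^×`. -/
structure IsAssociated (Ψ : E ≃ₗ⁅ℂ⁆ E) (ψ : T.roots → ℂˣ) : Prop where
  nonisotropic : ∀ α : T.roots, (α : Dual ℂ T.H) ∈ T.nonisotropicRoots →
    ∀ x ∈ T.rootSpace (α : Dual ℂ T.H), Ψ x = (ψ α : ℂ) • x
  isotropic : ∀ σ α β γ : T.roots, (σ : Dual ℂ T.H) ∈ T.isotropicRoots →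
    (α : Dual ℂ T.H) ∈ T.nonisotropicRoots → (β : Dual ℂ T.H) ∈ T.nonisotropicRoots →
    (β : Dual ℂ T.H) = α + σ → (γ : Dual ℂ T.H) = -α → ψ σ = ψ β * ψ γ

end SplitLieTriple

end

noncomputable section

open Module

/-! ### Root spaces, the induced form and sl₂-triples -/

namespace SplitLieTriple

variable {E : Type*} [LieRing E] [LieAlgebra ℂ E] (T : SplitLieTriple E)

/-! Each non-isotropic root vector lies in an sl₂-triple, and (A3) makes its nilpotent members act
locally nilpotently. Hence non-isotropic root spaces are lines, Ψ has a scalar φ(α) on each, and φ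
is multiplicative wherever a bracket is nonzero.

For simply laced type, isotropic roots σ are orthogonal to R^×. Rank > 1 gives every non-isotropic
root a neighbour with Cartan integer ±1, and with (A6) this connects R^× through A₂-triples α, β, α
+ β (`nonisotropicRoots_induction`). The ratio φ(α + σ)/φ(α) is constant along such triples, and
tameness supplies one α with α + σ ∈ R to start from (`exists_translation_factor`). This ratio is
the only possible ψ(σ); comparing translations shows that ψ is a character.

For x ∈ E_σ, the defect z = Ψx - φ(σ)x centralizes the core, so z lies in the core by tameness. As Ψ
preserves the pairing of the core with E, it multiplies z by φ(σ) (`apply_core`). If z ≠ 0, then x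
and z would span a nontrivial Jordan block, which finite order excludes. -/

theorem lie_mem_rootSpace {α β γ : Dual ℂ T.H} {x y : E} (hx : x ∈ T.rootSpace α)
    (hy : y ∈ T.rootSpace β) (hγ : α + β = γ) : ⁅x, y⁆ ∈ T.rootSpace γ := by
  subst hγ
  rw [mem_rootSpace] at *
  intro h
  rw [leibniz_lie, hx h, hy h, smul_lie, lie_smul, ← add_smul, LinearMap.add_apply]

theorem mem_rootSpace_zero {x : E} : x ∈ T.rootSpace 0 ↔ x ∈ T.H := by
  rw [mem_rootSpace, ← T.zero_eigenspace x]
  simp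

theorem eq_zero_of_notMem_roots {α : Dual ℂ T.H} (hα : α ∉ T.roots) {x : E}
    (hx : x ∈ T.rootSpace α) : x = 0 := by
  have : T.rootSpace α = ⊥ := not_not.1 hα
  simpa [this] using hx

theorem mem_roots_of_ne_zero {α : Dual ℂ T.H} {x : E} (hx : x ∈ T.rootSpace α) (h0 : x ≠ 0) :
    α ∈ T.roots :=
  fun h => h0 (by simpa [h] using hx)

theorem exists_ne_zero_of_mem_roots {α : Dual ℂ T.H} (hα : α ∈ T.roots) :
    ∃ x ∈ T.rootSpace α, x ≠ 0 :=
  Submodule.exists_mem_ne_zero_of_ne_bot hα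

theorem form_eq_zero_of_add_ne_zero {α β : Dual ℂ T.H} {x y : E} (hx : x ∈ T.rootSpace α)
    (hy : y ∈ T.rootSpace β) (h : α + β ≠ 0) : T.form x y = 0 := by
  obtain ⟨k, hk⟩ : ∃ k, (α + β) k ≠ 0 := by
    by_contra hcon
    push Not at hcon
    exact h (LinearMap.ext hcon)
  rw [mem_rootSpace] at hx hy
  have h1 := T.form_invariant x k y
  rw [← lie_skew, hx k, hy k] at h1
  simp only [map_neg, LinearMap.neg_apply, map_smul, LinearMap.smul_apply, smul_eq_mul] at h1
  have h2 : (α + β) k * T.form x y = 0 := by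
    rw [LinearMap.add_apply]
    linear_combination -h1
  exact (mul_eq_zero.1 h2).resolve_left hk

theorem rootSpace_induction {p : E → Prop}
    (mem : ∀ α, ∀ x ∈ T.rootSpace α, p x) (zero : p 0) (add : ∀ x y, p x → p y → p (x + y))
    (x : E) : p x := by
  have hx : x ∈ ⨆ α : Dual ℂ T.H, T.rootSpace α := by
    have := T.iSup_eigenspaces
    unfold rootSpace
    rw [this]
    trivial
  exact Submodule.iSup_induction T.rootSpace (motive := p) hx mem zero add

/-- The form pairs `E_α` and `E_{-α}` non-degenerately. -/
theorem eq_zero_of_form_eq_zero {α : Dual ℂ T.H} {x : E} (hx : x ∈ T.rootSpace α)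
    (h : ∀ y ∈ T.rootSpace (-α), T.form x y = 0) : x = 0 := by
  refine T.form_nondegenerate x fun y => ?_
  refine T.rootSpace_induction (p := fun y => T.form x y = 0) ?_ ?_ ?_ y
  · intro β y hy
    by_cases hβ : α + β = 0
    · exact h y (by rwa [neg_eq_of_add_eq_zero_right hβ])
    · exact T.form_eq_zero_of_add_ne_zero hx hy hβ
  · simp
  · intro y z hy hz
    simp [hy, hz]

theorem exists_form_eq {α : Dual ℂ T.H} {x : E} (hx : x ∈ T.rootSpace α) (h0 : x ≠ 0) (c : ℂ) :
    ∃ y ∈ T.rootSpace (-α), T.form x y = c := by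
  by_contra! hcon
  refine h0 (T.eq_zero_of_form_eq_zero hx fun y hy => ?_)
  by_contra hne
  refine hcon ((c / T.form x y) • y) (Submodule.smul_mem _ _ hy) ?_
  rw [map_smul, smul_eq_mul, div_mul_cancel₀ _ hne]

theorem neg_mem_roots {α : Dual ℂ T.H} (hα : α ∈ T.roots) : -α ∈ T.roots := by
  obtain ⟨x, hx, h0⟩ := T.exists_ne_zero_of_mem_roots hα
  obtain ⟨y, hy, h⟩ := T.exists_form_eq hx h0 1
  refine T.mem_roots_of_ne_zero hy ?_
  rintro rfl
  simp at h

theorem zero_mem_roots : (0 : Dual ℂ T.H) ∈ T.roots := by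
  obtain ⟨x, hx, h0⟩ : ∃ x ∈ T.H, x ≠ 0 := by
    by_contra! hcon
    exact T.H_ne_bot ((LieSubalgebra.eq_bot_iff T.H).2 hcon)
  exact T.mem_roots_of_ne_zero (T.mem_rootSpace_zero.2 hx) h0

theorem dualForm_apply (α β : Dual ℂ T.H) : T.dualForm α β = α (T.t β) := by
  rw [← T.form_t α, T.form_symm]; rfl

theorem dualForm_comm (α β : Dual ℂ T.H) : T.dualForm α β = T.dualForm β α := T.form_symm _ _

theorem dualForm_add_left (α β γ : Dual ℂ T.H) :
    T.dualForm (α + β) γ = T.dualForm α γ + T.dualForm β γ := by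
  simp [dualForm_apply]

theorem dualForm_add_right (α β γ : Dual ℂ T.H) :
    T.dualForm γ (α + β) = T.dualForm γ α + T.dualForm γ β := by
  simp [T.dualForm_comm γ, dualForm_add_left]

@[simp] theorem dualForm_neg_left (α β : Dual ℂ T.H) :
    T.dualForm (-α) β = -T.dualForm α β := by
  simp [dualForm_apply]

@[simp] theorem dualForm_neg_right (α β : Dual ℂ T.H) :
    T.dualForm α (-β) = -T.dualForm α β := by
  simp [T.dualForm_comm α]

theorem dualForm_zero_left (β : Dual ℂ T.H) : T.dualForm 0 β = 0 := by
  simp [dualForm_apply]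

theorem dualForm_add_self (α β : Dual ℂ T.H) :
    T.dualForm (α + β) (α + β) = T.dualForm α α + 2 * T.dualForm α β + T.dualForm β β := by
  rw [dualForm_add_left, dualForm_add_right, dualForm_add_right, T.dualForm_comm β α]
  ring

theorem neg_mem_nonisotropicRoots {α : Dual ℂ T.H} (hα : α ∈ T.nonisotropicRoots) :
    -α ∈ T.nonisotropicRoots :=
  ⟨T.neg_mem_roots hα.1, by simpa using hα.2⟩

theorem neg_mem_isotropicRoots {α : Dual ℂ T.H} (hα : α ∈ T.isotropicRoots) :
    -α ∈ T.isotropicRoots :=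
  ⟨T.neg_mem_roots hα.1, by simpa using hα.2⟩

theorem mem_isotropicRoots_or {α : Dual ℂ T.H} (hα : α ∈ T.roots) :
    α ∈ T.isotropicRoots ∨ α ∈ T.nonisotropicRoots := by
  by_cases h : T.dualForm α α = 0
  · exact .inl ⟨hα, h⟩
  · exact .inr ⟨hα, h⟩

theorem lie_t {α : Dual ℂ T.H} {x : E} (hx : x ∈ T.rootSpace α) (β : Dual ℂ T.H) :
    ⁅(T.t β : E), x⁆ = T.dualForm α β • x := by
  rw [dualForm_apply]
  exact T.mem_rootSpace.1 hx _

/-- `[x, y] = (x, y) t_α` for `x ∈ E_α`, `y ∈ E_{-α}`. -/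
theorem lie_eq_smul_t {α : Dual ℂ T.H} {x y : E} (hx : x ∈ T.rootSpace α)
    (hy : y ∈ T.rootSpace (-α)) : ⁅x, y⁆ = T.form x y • (T.t α : E) := by
  have hH : ⁅x, y⁆ ∈ T.H :=
    T.mem_rootSpace_zero.1 (T.lie_mem_rootSpace hx hy (add_neg_cancel α))
  have key : (⟨⁅x, y⁆, hH⟩ - T.form x y • T.t α : T.H) = 0 := by
    refine T.formH_eq_zero fun h => ?_
    rw [formH_apply, T.form_symm]
    have h1 := T.form_invariant (h : E) x y
    rw [T.mem_rootSpace.1 hx h] at h1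
    have h2 := T.form_t α h
    simp only [map_smul, LinearMap.smul_apply, smul_eq_mul] at h1
    rw [AddSubgroupClass.coe_sub, SetLike.val_smul, map_sub, map_smul, smul_eq_mul, ← h1, h2]
    ring
  have := congrArg (Subtype.val) key
  simpa [sub_eq_zero] using this

/-- Root vectors `e ∈ E_α`, `f ∈ E_{-α}` with `(e, f) = 2 / (α, α)` form an `sl₂`-triple. -/
theorem exists_isSl2Triple {α : Dual ℂ T.H} (hα : α ∈ T.nonisotropicRoots) {e : E}
    (he : e ∈ T.rootSpace α) (h0 : e ≠ 0) :
    ∃ f ∈ T.rootSpace (-α), IsSl2Triple ((2 / T.dualForm α α) • (T.t α : E)) e f := by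
  obtain ⟨f, hf, hef⟩ := T.exists_form_eq he h0 (2 / T.dualForm α α)
  have hne := hα.2
  have h1 : ⁅(2 / T.dualForm α α) • (T.t α : E), e⁆ = 2 • e := by
    rw [smul_lie, T.lie_t he, smul_smul, div_mul_cancel₀ _ hne, two_smul, two_nsmul]
  refine ⟨f, hf, ⟨?_, ?_, h1, ?_⟩⟩
  · intro h
    rw [h, zero_lie] at h1
    rw [eq_comm, two_nsmul, ← two_smul ℂ, smul_eq_zero] at h1
    exact h0 (h1.resolve_left two_ne_zero)
  · rw [T.lie_eq_smul_t he hf, hef]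
  · rw [smul_lie, T.lie_t hf, smul_smul, dualForm_neg_left, mul_neg, div_mul_cancel₀ _ hne,
      neg_smul, two_smul, two_nsmul]

/-- The centralizer of all non-isotropic root spaces centralizes the core. -/
theorem lie_core_eq_zero {x : E} (h : ∀ α ∈ T.nonisotropicRoots, ∀ y ∈ T.rootSpace α, ⁅x, y⁆ = 0) :
    ∀ y ∈ T.core, ⁅x, y⁆ = 0 := by
  intro y hy
  induction hy using LieSubalgebra.lieSpan_induction with
  | mem y hy =>
    simp only [Set.mem_iUnion] at hy
    obtain ⟨α, hα, hy⟩ := hy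
    exact h α hα y hy
  | zero => simp
  | add u v _ _ hu hv => rw [lie_add, hu, hv, add_zero]
  | smul c u _ hu => rw [lie_smul, hu, smul_zero]
  | lie u v _ _ hu hv => rw [leibniz_lie, hu, hv, zero_lie, lie_zero, add_zero]

/-- The core is orthogonal to the isotropic root vectors that centralize it. -/
theorem form_core_eq_zero {σ : Dual ℂ T.H} (hσ : σ ∈ T.isotropicRoots) {y : E}
    (hy : y ∈ T.rootSpace σ) (h : ∀ z ∈ T.core, ⁅y, z⁆ = 0) :
    ∀ x ∈ T.core, T.form x y = 0 := by
  intro x hx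
  induction hx using LieSubalgebra.lieSpan_induction with
  | mem x hx =>
    simp only [Set.mem_iUnion] at hx
    obtain ⟨α, hα, hx⟩ := hx
    refine T.form_eq_zero_of_add_ne_zero hx hy fun hcon => hα.2 ?_
    rw [eq_neg_of_add_eq_zero_left hcon]
    simpa using hσ.2
  | zero => simp
  | add u v _ _ hu hv => rw [map_add, LinearMap.add_apply, hu, hv, add_zero]
  | smul c u _ hu => rw [map_smul, LinearMap.smul_apply, hu, smul_zero]
  | lie u v _ hv _ _ =>
    rw [T.form_invariant, ← lie_skew, h v hv, neg_zero, map_zero]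

section CartanAut

variable {T} {Ψ : E ≃ₗ⁅ℂ⁆ E} (hΨ : T.IsCartanAut Ψ)
include hΨ

theorem IsCartanAut.map_mem_rootSpace {α : Dual ℂ T.H} {x : E} (hx : x ∈ T.rootSpace α) :
    Ψ x ∈ T.rootSpace α := by
  rw [mem_rootSpace] at *
  intro h
  rw [← map_smul, ← hx h, LieEquiv.map_lie, hΨ h h.2]

end CartanAut

/-! ### Orthogonality of isotropic and non-isotropic roots -/

section SimplyLaced

variable {T} (hT : T.IsSimplyLaced)
include hT

theorem IsSimplyLaced.dualForm_self {α β : Dual ℂ T.H} (hα : α ∈ T.nonisotropicRoots)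
    (hβ : β ∈ T.roots) : T.dualForm β β = 0 ∨ T.dualForm β β = T.dualForm α α := by
  by_cases h : T.dualForm β β = 0
  · exact .inl h
  · exact .inr (hT β ⟨hβ, h⟩ α hα)

/-- A trace argument: if (α, σ) ≠ 0, the span of e and [x, e] is stable under x and y, and t_σ = [x,
y] acts on it by the scalar (α, σ). The trace of a commutator is zero, a contradiction. -/
theorem IsSimplyLaced.dualForm_eq_zero_of_sub_notMem {σ α : Dual ℂ T.H}
    (hσ : σ ∈ T.isotropicRoots) (hα : α ∈ T.nonisotropicRoots) (h : α + -σ ∉ T.roots) :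
    T.dualForm α σ = 0 := by
  by_contra hc
  obtain ⟨x, hx, hx0⟩ := T.exists_ne_zero_of_mem_roots hσ.1
  obtain ⟨y, hy, hxy⟩ := T.exists_form_eq hx hx0 1
  obtain ⟨e, he, he0⟩ := T.exists_ne_zero_of_mem_roots hα.1
  have ht : ⁅x, y⁆ = T.t σ := by rw [T.lie_eq_smul_t hx hy, hxy, one_smul]
  have hye : ⁅y, e⁆ = 0 :=
    T.eq_zero_of_notMem_roots h (T.lie_mem_rootSpace hy he (add_comm _ _))
  have hw : ⁅x, e⁆ ∈ T.rootSpace (α + σ) := T.lie_mem_rootSpace hx he (add_comm _ _)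
  have hyw : ⁅y, ⁅x, e⁆⁆ = -(T.dualForm α σ • e) := by
    rw [leibniz_lie, hye, lie_zero, add_zero, ← lie_skew y x, ht, neg_lie, T.lie_t he]
  by_cases hw0 : ⁅x, e⁆ = 0
  · rw [hw0, lie_zero, eq_comm, neg_eq_zero, smul_eq_zero] at hyw
    exact hyw.elim hc he0
  · have h1 := T.mem_roots_of_ne_zero hw hw0
    have h2 := hT.dualForm_self hα h1
    rw [dualForm_add_self, hσ.2] at h2
    have h3 : T.dualForm α α = -2 * T.dualForm α σ := by
      rcases h2 with h2 | h2
      · linear_combination h2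
      · exact absurd (by linear_combination h2 / 2) hc
    -- Otherwise α + 2σ is a root of square length 2(α, σ), which is neither 0 nor (α, α) = -2(α,
    -- σ).
    have hxw : ⁅x, ⁅x, e⁆⁆ = 0 := by
      by_contra hne
      have h4 := T.mem_roots_of_ne_zero (T.lie_mem_rootSpace hx hw rfl) hne
      have h5 := hT.dualForm_self hα h4
      rw [dualForm_add_self, dualForm_add_right, T.dualForm_comm σ α, dualForm_add_self, hσ.2,
        h3] at h5
      rcases h5 with h5 | h5
      · exact hc (by linear_combination h5 / 2)
      · exact hc (by linear_combination h5 / 4)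
    have h6 := T.lie_t hw σ
    rw [← ht, lie_lie, hyw, hxw, lie_zero, sub_zero, lie_neg, lie_smul, dualForm_add_left,
      hσ.2, add_zero, ← neg_smul, ← sub_eq_zero, ← sub_smul, smul_eq_zero] at h6
    rcases h6 with h6 | h6
    · exact hc (by linear_combination -h6 / 2)
    · exact hw0 h6

/-- Isotropic roots are orthogonal to non-isotropic roots. -/
theorem IsSimplyLaced.dualForm_eq_zero {σ α : Dual ℂ T.H}
    (hσ : σ ∈ T.isotropicRoots) (hα : α ∈ T.nonisotropicRoots) : T.dualForm α σ = 0 := by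
  by_cases h1 : α + -σ ∈ T.roots
  -- The square lengths of α ± σ sum to 2(α, α) ≠ 0, so they do not both vanish; one equals (α, α).
  · by_cases h2 : α + - -σ ∈ T.roots
    · have h3 := hT.dualForm_self hα h1
      have h4 := hT.dualForm_self hα h2
      rw [dualForm_add_self] at h3 h4
      simp only [dualForm_neg_right, dualForm_neg_left, neg_neg, hσ.2, neg_zero, add_zero] at h3 h4
      rcases h3 with h3 | h3
      · rcases h4 with h4 | h4
        · exact absurd (by linear_combination (h3 + h4) / 2) hα.2
        · linear_combination h4 / 2
      · linear_combination -h3 / 2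
    · simpa using hT.dualForm_eq_zero_of_sub_notMem (T.neg_mem_isotropicRoots hσ) hα h2
  · exact hT.dualForm_eq_zero_of_sub_notMem hσ hα h1

theorem IsSimplyLaced.add_mem_nonisotropicRoots {σ α : Dual ℂ T.H}
    (hσ : σ ∈ T.isotropicRoots) (hα : α ∈ T.nonisotropicRoots) (h : α + σ ∈ T.roots) :
    α + σ ∈ T.nonisotropicRoots := by
  refine ⟨h, ?_⟩
  rw [dualForm_add_self, hT.dualForm_eq_zero hσ hα, hσ.2]
  simpa using hα.2

end SimplyLaced

end SplitLieTriple

/-! ### Consequences of sl₂-theory -/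

namespace ExtendedAffineLieAlgebra

variable {E : Type*} [LieRing E] [LieAlgebra ℂ E] (L : ExtendedAffineLieAlgebra E)

/-- A root vector annihilated by a non-isotropic root vector has non-negative weight. -/
theorem exists_nat_of_lie_eq_zero {α β : Dual ℂ L.H} (hα : α ∈ L.nonisotropicRoots) {e x : E}
    (he : e ∈ L.rootSpace α) (he0 : e ≠ 0) (hx : x ∈ L.rootSpace β) (hx0 : x ≠ 0)
    (hex : ⁅e, x⁆ = 0) : ∃ n : ℕ, 2 * L.dualForm β α = n * L.dualForm α α := by
  obtain ⟨f, hf, t⟩ := L.exists_isSl2Triple hα he he0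
  have P : t.HasPrimitiveVectorWith x (2 / L.dualForm α α * L.dualForm β α) :=
    ⟨hx0, by rw [smul_lie, L.lie_t hx, smul_smul], hex⟩
  classical
  have hnil := L.ad_locally_nilpotent (-α) (L.neg_mem_nonisotropicRoots hα) f hf x
  obtain ⟨k, hk⟩ : ∃ k, Nat.find hnil = k + 1 := by
    refine Nat.exists_eq_succ_of_ne_zero fun h => hx0 ?_
    simpa [h] using Nat.find_spec hnil
  -- With μ the weight of x, e f^(k+1) x = (k+1)(μ - k) f^k x. The left side vanishes and f^k x does
  -- not, so μ = k.
  have h1 := P.lie_e_pow_succ_toEnd_f k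
  have h2 : ((LieAlgebra.ad ℂ E f) ^ (k + 1)) x = 0 := hk ▸ Nat.find_spec hnil
  have h3 : ((LieAlgebra.ad ℂ E f) ^ k) x ≠ 0 := Nat.find_min hnil (by omega)
  have h4 : ((LieModule.toEnd ℂ E E f) ^ (k + 1)) x = 0 := h2
  rw [h4, lie_zero, eq_comm, smul_eq_zero] at h1
  have h5 := h1.resolve_right h3
  refine ⟨k, ?_⟩
  have h6 := (mul_eq_zero.1 h5).resolve_left (Nat.cast_add_one_ne_zero k)
  have h7 := hα.2
  field_simp at h6
  linear_combination h6

/-- A vector of negative weight cannot be primitive. This is the source of all nonzero brackets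
below. -/
theorem lie_ne_zero_of_dualForm_eq {α β : Dual ℂ L.H} (hα : α ∈ L.nonisotropicRoots) {m : ℕ}
    (h : 2 * L.dualForm β α = -((m + 1 : ℕ) * L.dualForm α α)) {e x : E}
    (he : e ∈ L.rootSpace α) (he0 : e ≠ 0) (hx : x ∈ L.rootSpace β) (hx0 : x ≠ 0) :
    ⁅e, x⁆ ≠ 0 := by
  intro hex
  obtain ⟨n, hn⟩ := L.exists_nat_of_lie_eq_zero hα he he0 hx hx0 hex
  have : ((n + (m + 1) : ℕ) : ℂ) * L.dualForm α α = 0 := by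
    push_cast at h ⊢
    linear_combination h - hn
  rcases mul_eq_zero.1 this with h1 | h1
  · have := Nat.cast_eq_zero.1 h1
    omega
  · exact hα.2 h1

/-- Non-isotropic root spaces are one-dimensional. -/
theorem exists_smul_eq {α : Dual ℂ L.H} (hα : α ∈ L.nonisotropicRoots) {x y : E}
    (hx : x ∈ L.rootSpace α) (hx0 : x ≠ 0) (hy : y ∈ L.rootSpace α) : ∃ c : ℂ, y = c • x := by
  obtain ⟨e, he, hxe⟩ := L.exists_form_eq hx hx0 1
  refine ⟨L.form y e, ?_⟩
  have hz : y - L.form y e • x ∈ L.rootSpace α := Submodule.sub_mem _ hy (Submodule.smul_mem _ _ hx)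
  by_contra hne
  -- The difference has weight -2 for the triple of -α, yet e kills it because it pairs to zero with
  -- e.
  refine L.lie_ne_zero_of_dualForm_eq (L.neg_mem_nonisotropicRoots hα) (β := α) (m := 1)
    (by simp) he ?_ hz (sub_ne_zero.2 hne) ?_
  · rintro rfl
    simp at hxe
  · rw [← lie_skew, L.lie_eq_smul_t hz he]
    simp [hxe]

variable {L}

/-! ### Connectedness of the non-isotropic roots -/

section SimplyLaced

variable (hL : L.IsSimplyLaced)
include hL

theorem add_mem_nonisotropicRoots {α β : Dual ℂ L.H} (hα : α ∈ L.nonisotropicRoots)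
    (hβ : β ∈ L.nonisotropicRoots) (h : 2 * L.dualForm β α = -L.dualForm α α) :
    α + β ∈ L.nonisotropicRoots := by
  obtain ⟨e, he, he0⟩ := L.exists_ne_zero_of_mem_roots hα.1
  obtain ⟨x, hx, hx0⟩ := L.exists_ne_zero_of_mem_roots hβ.1
  refine ⟨L.mem_roots_of_ne_zero (L.lie_mem_rootSpace he hx rfl)
    (L.lie_ne_zero_of_dualForm_eq hα (m := 0) (by simpa using h) he he0 hx hx0), ?_⟩
  rw [L.dualForm_add_self, L.dualForm_comm α β, h, hL β hβ α hα]
  simpa using hα.2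

theorem mem_isotropicRoots_or_of_add_mem {α β : Dual ℂ L.H} (hα : α ∈ L.nonisotropicRoots)
    (hβ : β ∈ L.nonisotropicRoots) (h : α + β ∈ L.roots) :
    α + β ∈ L.isotropicRoots ∨ 2 * L.dualForm β α = -L.dualForm α α := by
  rcases hL.dualForm_self hα h with h1 | h1
  · exact .inl ⟨h, h1⟩
  · rw [L.dualForm_add_self, L.dualForm_comm α β, hL β hβ α hα] at h1
    exact .inr (by linear_combination h1)

/-- The possible relative positions of two non-isotropic roots. -/
theorem dualForm_cases {α β : Dual ℂ L.H} (hα : α ∈ L.nonisotropicRoots)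
    (hβ : β ∈ L.nonisotropicRoots) (h : L.dualForm β α ≠ 0) :
    α + β ∈ L.isotropicRoots ∨ -α + β ∈ L.isotropicRoots ∨
      2 * L.dualForm β α = -L.dualForm α α ∨ 2 * L.dualForm β α = L.dualForm α α := by
  have hα' := L.neg_mem_nonisotropicRoots hα
  obtain ⟨e, he, he0⟩ := L.exists_ne_zero_of_mem_roots hα.1
  obtain ⟨f, hf, hf0⟩ := L.exists_ne_zero_of_mem_roots hα'.1
  obtain ⟨x, hx, hx0⟩ := L.exists_ne_zero_of_mem_roots hβ.1
  by_cases h1 : ⁅e, x⁆ = 0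
  · by_cases h2 : ⁅f, x⁆ = 0
    -- Killed by both e and f, x has a weight that is both ≥ 0 and ≤ 0.
    · obtain ⟨n, hn⟩ := L.exists_nat_of_lie_eq_zero hα he he0 hx hx0 h1
      obtain ⟨m, hm⟩ := L.exists_nat_of_lie_eq_zero hα' hf hf0 hx hx0 h2
      simp only [SplitLieTriple.dualForm_neg_left, SplitLieTriple.dualForm_neg_right, neg_neg] at hm
      have h3 : ((n + m : ℕ) : ℂ) * L.dualForm α α = 0 := by
        push_cast
        linear_combination -hn - hm
      have h4 := Nat.cast_eq_zero.1 ((mul_eq_zero.1 h3).resolve_right hα.2)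
      obtain rfl : n = 0 := by omega
      simp [h] at hn
    · rcases mem_isotropicRoots_or_of_add_mem hL hα' hβ
        (L.mem_roots_of_ne_zero (L.lie_mem_rootSpace hf hx rfl) h2) with h3 | h3
      · exact .inr (.inl h3)
      · refine .inr (.inr (.inr ?_))
        simp only [SplitLieTriple.dualForm_neg_left, SplitLieTriple.dualForm_neg_right,
          neg_neg] at h3
        linear_combination -h3
  · rcases mem_isotropicRoots_or_of_add_mem hL hα hβ
      (L.mem_roots_of_ne_zero (L.lie_mem_rootSpace he hx rfl) h1) with h3 | h3
    · exact .inl h3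
    · exact .inr (.inr (.inl h3))

theorem dualForm_eq_of_neg_add_mem {α β γ : Dual ℂ L.H} (h : -α + β ∈ L.isotropicRoots)
    (hγ : γ ∈ L.nonisotropicRoots) : L.dualForm β γ = L.dualForm α γ := by
  have h1 := hL.dualForm_eq_zero h hγ
  rw [L.dualForm_add_right, L.dualForm_neg_right, L.dualForm_comm γ, L.dualForm_comm γ] at h1
  linear_combination h1

theorem dualForm_eq_of_add_mem {α β γ : Dual ℂ L.H} (h : α + β ∈ L.isotropicRoots)
    (hγ : γ ∈ L.nonisotropicRoots) : L.dualForm β γ = -L.dualForm α γ := by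
  have h1 := dualForm_eq_of_neg_add_mem hL (α := -α) (β := β) (by simpa using h) hγ
  simpa using h1

omit hL in
theorem rank_le_one_of_forall {α : Dual ℂ L.H} (hα : α ∈ L.nonisotropicRoots)
    (h : ∀ β ∈ L.nonisotropicRoots, α + β ∈ L.isotropicRoots ∨ -α + β ∈ L.isotropicRoots) :
    L.rank ≤ 1 := by
  have hαV : α ∈ L.realSpan := Submodule.subset_span hα.1
  have key : ∀ v ∈ L.realSpan, ∃ c : ℝ, v - c • α ∈ L.isotropicRealSpan := by
    intro v hv
    induction hv using Submodule.span_induction with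
    | mem v hv =>
      rcases L.mem_isotropicRoots_or hv with hv | hv
      · refine ⟨0, ?_⟩
        rw [zero_smul, sub_zero]
        exact Submodule.subset_span hv
      · rcases h v hv with h1 | h1
        · refine ⟨-1, ?_⟩
          have : v - (-1 : ℝ) • α = α + v := by
            rw [neg_smul, one_smul]
            abel
          rw [this]
          exact Submodule.subset_span h1
        · refine ⟨1, ?_⟩
          have : v - (1 : ℝ) • α = -α + v := by
            rw [one_smul]
            abel
          rw [this]
          exact Submodule.subset_span h1
    | zero => exact ⟨0, by simp⟩
    | add v w _ _ hv hw =>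
      obtain ⟨c, hc⟩ := hv
      obtain ⟨d, hd⟩ := hw
      refine ⟨c + d, ?_⟩
      have : v + w - (c + d) • α = v - c • α + (w - d • α) := by
        rw [add_smul]
        abel
      rw [this]
      exact Submodule.add_mem _ hc hd
    | smul r v _ hv =>
      obtain ⟨c, hc⟩ := hv
      refine ⟨r * c, ?_⟩
      rw [mul_smul, ← smul_sub]
      exact Submodule.smul_mem _ _ hc
  refine finrank_le_one (Submodule.Quotient.mk ⟨α, hαV⟩) fun w => ?_
  obtain ⟨⟨v, hv⟩, rfl⟩ := Submodule.Quotient.mk_surjective _ w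
  obtain ⟨c, hc⟩ := key v hv
  refine ⟨c, ?_⟩
  rw [← Submodule.Quotient.mk_smul, eq_comm, Submodule.Quotient.eq]
  exact hc

variable (hrank : 1 < L.rank)
include hrank

/-- In rank `> 1`, every non-isotropic root has a neighbour with Cartan integer `±1`. -/
theorem exists_dualForm_eq {α : Dual ℂ L.H} (hα : α ∈ L.nonisotropicRoots) :
    ∃ β ∈ L.nonisotropicRoots,
      2 * L.dualForm β α = -L.dualForm α α ∨ 2 * L.dualForm β α = L.dualForm α α := by
  by_contra! hcon
  have hcase : ∀ β ∈ L.nonisotropicRoots, L.dualForm β α ≠ 0 →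
      α + β ∈ L.isotropicRoots ∨ -α + β ∈ L.isotropicRoots := by
    intro β hβ h
    rcases dualForm_cases hL hα hβ h with h1 | h1 | h1 | h1
    · exact .inl h1
    · exact .inr h1
    · exact absurd h1 (hcon β hβ).1
    · exact absurd h1 (hcon β hβ).2
  by_cases hex : ∃ β ∈ L.nonisotropicRoots, L.dualForm β α = 0
  · obtain ⟨β₀, hβ₀, hβ₀'⟩ := hex
    -- Roots not orthogonal to α are now ±α modulo isotropic roots, hence orthogonal to every root
    -- orthogonal to α.
    obtain ⟨β, hβ, γ, hγ, hβγ⟩ := L.indecomposable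
      {β | β ∈ L.nonisotropicRoots ∧ L.dualForm β α ≠ 0}
      {β | β ∈ L.nonisotropicRoots ∧ L.dualForm β α = 0}
      (by ext β; simp only [Set.mem_union, Set.mem_ofPred_eq]; tauto)
      (Set.disjoint_left.2 fun β h1 h2 => h1.2 h2.2) ⟨α, hα, hα.2⟩ ⟨β₀, hβ₀, hβ₀'⟩
    refine hβγ ?_
    rcases hcase β hβ.1 hβ.2 with h1 | h1
    · rw [dualForm_eq_of_add_mem hL h1 hγ.1, L.dualForm_comm, hγ.2, neg_zero]
    · rw [dualForm_eq_of_neg_add_mem hL h1 hγ.1, L.dualForm_comm, hγ.2]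
  · push Not at hex
    exact absurd (rank_le_one_of_forall hα fun β hβ => hcase β hβ (hex β hβ)) (by omega)

/-- A property of non-isotropic roots that propagates along `A₂`-subsystems holds for all of them
as soon as it holds for one. -/
theorem nonisotropicRoots_induction {p : Dual ℂ L.H → Prop} {α : Dual ℂ L.H}
    (hα : α ∈ L.nonisotropicRoots) (hp : p α)
    (step : ∀ α ∈ L.nonisotropicRoots, ∀ β ∈ L.nonisotropicRoots,
      2 * L.dualForm β α = -L.dualForm α α → p α → p β ∧ p (α + β)) :
    ∀ β ∈ L.nonisotropicRoots, p β := by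
  have step' : ∀ α ∈ L.nonisotropicRoots, ∀ β ∈ L.nonisotropicRoots,
      2 * L.dualForm β α = -L.dualForm α α ∨ 2 * L.dualForm β α = L.dualForm α α →
      p α → p β := by
    rintro α hα β hβ (h | h) hp
    · exact (step α hα β hβ h hp).1
    · have hβ' := L.neg_mem_nonisotropicRoots hβ
      have h1 : 2 * L.dualForm (-β) α = -L.dualForm α α := by
        rw [L.dualForm_neg_left]
        linear_combination -h
      have h2 := add_mem_nonisotropicRoots hL hα hβ' h1
      -- The passage from α to β goes through α - β, which has Cartan integer -1 with β.
      refine (step _ h2 β hβ ?_ (step α hα _ hβ' h1 hp).2).1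
      rw [hL _ h2 α hα, L.dualForm_add_right, L.dualForm_neg_right, hL β hβ α hα]
      linear_combination h
  by_contra! hcon
  obtain ⟨β₀, hβ₀, hpβ₀⟩ := hcon
  obtain ⟨α, ⟨hα, hp⟩, β, ⟨hβ, hpβ⟩, h⟩ := L.indecomposable
    {β | β ∈ L.nonisotropicRoots ∧ p β} {β | β ∈ L.nonisotropicRoots ∧ ¬ p β}
    (by ext β; simp only [Set.mem_union, Set.mem_ofPred_eq]; tauto)
    (Set.disjoint_left.2 fun β h1 h2 => h2.2 h1.2) ⟨α, hα, hp⟩ ⟨β₀, hβ₀, hpβ₀⟩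
  refine hpβ ?_
  -- If β is ±α modulo an isotropic root, a neighbour γ of α is also a neighbour of β and serves as
  -- a bridge.
  obtain ⟨γ, hγ, hγα⟩ := exists_dualForm_eq hL hrank hα
  have hpγ := step' α hα γ hγ hγα hp
  have hαγ := hL α hα γ hγ
  rw [L.dualForm_comm γ] at hγα
  rw [L.dualForm_comm] at h
  rcases dualForm_cases hL hα hβ h with h1 | h1 | h1 | h1
  · refine step' γ hγ β hβ ?_ hpγ
    rw [dualForm_eq_of_add_mem hL h1 hγ]
    rcases hγα with h2 | h2
    · exact .inr (by linear_combination -h2 + hαγ)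
    · exact .inl (by linear_combination -h2 - hαγ)
  · refine step' γ hγ β hβ ?_ hpγ
    rw [dualForm_eq_of_neg_add_mem hL h1 hγ]
    rcases hγα with h2 | h2
    · exact .inl (by linear_combination h2 - hαγ)
    · exact .inr (by linear_combination h2 + hαγ)
  · exact step' α hα β hβ (.inl h1) hp
  · exact step' α hα β hβ (.inr h1) hp

omit hL in
theorem nonisotropicRoots_nonempty : L.nonisotropicRoots.Nonempty := by
  by_contra! hcon
  have h : L.realSpan ≤ L.isotropicRealSpan := Submodule.span_mono fun α hα =>
    (L.mem_isotropicRoots_or hα).resolve_right (by simp [hcon])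
  have h1 : L.rank ≤ 1 := by
    refine finrank_le_one 0 fun w => ⟨0, ?_⟩
    obtain ⟨⟨v, hv⟩, rfl⟩ := Submodule.Quotient.mk_surjective _ w
    rw [smul_zero, eq_comm, Submodule.Quotient.mk_eq_zero]
    exact h hv
  omega

omit hL hrank in
/-- Tameness: isotropic roots are not isolated. -/
theorem exists_add_mem_roots {σ : Dual ℂ L.H} (hσ : σ ∈ L.isotropicRoots) :
    ∃ α ∈ L.nonisotropicRoots, α + σ ∈ L.roots := by
  -- If σ were isolated, E_σ and E_{-σ} would centralize the core. Then E_σ lies in the core and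
  -- E_{-σ} is orthogonal to it, against the non-degenerate pairing.
  by_contra! hcon
  have hx : ∀ x ∈ L.rootSpace σ, ∀ y ∈ L.core, ⁅x, y⁆ = 0 := fun x hx =>
    L.lie_core_eq_zero fun α hα y hy =>
      L.eq_zero_of_notMem_roots (hcon α hα) (L.lie_mem_rootSpace hx hy (add_comm _ _))
  have hy : ∀ x ∈ L.rootSpace (-σ), ∀ y ∈ L.core, ⁅x, y⁆ = 0 := fun x hx =>
    L.lie_core_eq_zero fun α hα y hy => by
      refine L.eq_zero_of_notMem_roots (fun h => ?_) (L.lie_mem_rootSpace hx hy rfl)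
      exact hcon (-α) (L.neg_mem_nonisotropicRoots hα)
        (by simpa [add_comm] using L.neg_mem_roots h)
  obtain ⟨x, hxσ, hx0⟩ := L.exists_ne_zero_of_mem_roots hσ.1
  have hxc := L.tame x (hx x hxσ)
  exact hx0 (L.eq_zero_of_form_eq_zero hxσ fun y hyσ =>
    L.form_core_eq_zero (L.neg_mem_isotropicRoots hσ) hyσ (hy y hyσ) x hxc)

end SimplyLaced

/-- `φ` gives the eigenvalues of `Ψ` on the non-isotropic root spaces. -/
def IsEigenvalueMap (L : ExtendedAffineLieAlgebra E) (Ψ : E ≃ₗ⁅ℂ⁆ E)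
    (φ : Dual ℂ L.H → ℂˣ) : Prop :=
  ∀ α ∈ L.nonisotropicRoots, ∀ x ∈ L.rootSpace α, Ψ x = (φ α : ℂ) • x

/-- `φ` is compatible with translations of non-isotropic roots by isotropic roots. -/
def IsTranslationCompatible (L : ExtendedAffineLieAlgebra E) (φ : Dual ℂ L.H → ℂˣ) : Prop :=
  ∀ σ ∈ L.isotropicRoots, ∀ α ∈ L.nonisotropicRoots,
    α + σ ∈ L.nonisotropicRoots ∧ φ (α + σ) = φ σ * φ α

/-! ### Eigenvalues of a Cartan automorphism -/

section CartanAut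

variable {Ψ : E ≃ₗ⁅ℂ⁆ E}

theorem exists_isEigenvalueMap (hΨ : L.IsCartanAut Ψ) :
    ∃ φ : Dual ℂ L.H → ℂˣ, L.IsEigenvalueMap Ψ φ := by
  have key : ∀ α : Dual ℂ L.H, ∃ u : ℂˣ, α ∈ L.nonisotropicRoots →
      ∀ x ∈ L.rootSpace α, Ψ x = (u : ℂ) • x := by
    intro α
    by_cases hα : α ∈ L.nonisotropicRoots
    · obtain ⟨x, hx, hx0⟩ := L.exists_ne_zero_of_mem_roots hα.1
      obtain ⟨c, hc⟩ := L.exists_smul_eq hα hx hx0 (hΨ.map_mem_rootSpace hx)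
      have hc0 : c ≠ 0 := by
        rintro rfl
        rw [zero_smul] at hc
        exact hx0 (Ψ.injective (hc.trans (map_zero Ψ).symm))
      refine ⟨Units.mk0 c hc0, fun _ y hy => ?_⟩
      obtain ⟨d, rfl⟩ := L.exists_smul_eq hα hx hx0 hy
      rw [map_smul, hc, Units.val_mk0, smul_comm]
    · exact ⟨1, fun h => absurd h hα⟩
  choose φ hφ using key
  exact ⟨φ, hφ⟩

variable {φ : Dual ℂ L.H → ℂˣ}

/-- Ψ fixes t_α, a nonzero bracket of E_α with E_{-α}. -/
theorem IsEigenvalueMap.mul_neg (hφ : L.IsEigenvalueMap Ψ φ) (hΨ : L.IsCartanAut Ψ)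
    {α : Dual ℂ L.H} (hα : α ∈ L.nonisotropicRoots) : φ α * φ (-α) = 1 := by
  obtain ⟨x, hx, hx0⟩ := L.exists_ne_zero_of_mem_roots hα.1
  obtain ⟨y, hy, hxy⟩ := L.exists_form_eq hx hx0 1
  have h1 : ⁅x, y⁆ = L.t α := by rw [L.lie_eq_smul_t hx hy, hxy, one_smul]
  have ht0 : (L.t α : E) ≠ 0 := fun h => hα.2 (by simp [SplitLieTriple.dualForm, h])
  have h2 := hΨ (L.t α) (L.t α).2
  rw [← h1, LieEquiv.map_lie, hφ α hα x hx, hφ _ (L.neg_mem_nonisotropicRoots hα) y hy, smul_lie,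
    lie_smul, smul_smul, h1, ← sub_eq_zero] at h2
  have h3 : (φ α * φ (-α) - 1 : ℂ) • (L.t α : E) = 0 := by rw [sub_smul, one_smul, h2]
  exact Units.ext (by simpa using sub_eq_zero.1 ((smul_eq_zero.1 h3).resolve_right ht0))

theorem IsEigenvalueMap.map_add (hφ : L.IsEigenvalueMap Ψ φ) (hL : L.IsSimplyLaced)
    {α β : Dual ℂ L.H} (hα : α ∈ L.nonisotropicRoots) (hβ : β ∈ L.nonisotropicRoots)
    (h : 2 * L.dualForm β α = -L.dualForm α α) : φ (α + β) = φ α * φ β := by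
  obtain ⟨e, he, he0⟩ := L.exists_ne_zero_of_mem_roots hα.1
  obtain ⟨x, hx, hx0⟩ := L.exists_ne_zero_of_mem_roots hβ.1
  have hne := L.lie_ne_zero_of_dualForm_eq hα (m := 0) (by simpa using h) he he0 hx hx0
  have h2 := hφ _ (add_mem_nonisotropicRoots hL hα hβ h) _ (L.lie_mem_rootSpace he hx rfl)
  rw [LieEquiv.map_lie, hφ α hα e he, hφ β hβ x hx, smul_lie, lie_smul, smul_smul, ← sub_eq_zero,
    ← sub_smul, smul_eq_zero] at h2
  exact Units.ext (by simpa using (sub_eq_zero.1 (h2.resolve_right hne)).symm)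

/-- Translation by an isotropic root preserves the non-isotropic roots and rescales the
eigenvalues by a constant factor. -/
theorem IsEigenvalueMap.exists_translation_factor (hφ : L.IsEigenvalueMap Ψ φ)
    (hΨ : L.IsCartanAut Ψ) (hL : L.IsSimplyLaced) (hrank : 1 < L.rank) {σ : Dual ℂ L.H}
    (hσ : σ ∈ L.isotropicRoots) :
    ∃ c : ℂˣ, ∀ α ∈ L.nonisotropicRoots, α + σ ∈ L.nonisotropicRoots ∧ φ (α + σ) = c * φ α := by
  obtain ⟨α₀, hα₀, h₀⟩ := exists_add_mem_roots hσ
  refine ⟨φ (α₀ + σ) / φ α₀, nonisotropicRoots_induction hL hrank hα₀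
    ⟨hL.add_mem_nonisotropicRoots hσ hα₀ h₀, by rw [div_mul_cancel]⟩ ?_⟩
  rintro α hα β hβ h ⟨hασ, hc⟩
  have hαβ := add_mem_nonisotropicRoots hL hα hβ h
  have hσα := hL.dualForm_eq_zero hσ hα
  have hσβ := hL.dualForm_eq_zero hσ hβ
  have h1 : 2 * L.dualForm β (α + σ) = -L.dualForm (α + σ) (α + σ) := by
    rw [hL _ hασ α hα, L.dualForm_add_right, hσβ, add_zero, h]
  have hαβσ := add_mem_nonisotropicRoots hL hασ hβ h1
  -- β + σ is reached as -α + (α + σ + β), again a sum with Cartan integer -1.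
  have h2 : 2 * L.dualForm (α + σ + β) (-α) = -L.dualForm (-α) (-α) := by
    rw [L.dualForm_neg_right, L.dualForm_neg_left, L.dualForm_add_left, L.dualForm_add_left,
      L.dualForm_comm σ α, hσα, L.dualForm_neg_right]
    linear_combination -h
  have hα' := L.neg_mem_nonisotropicRoots hα
  have h3 := add_mem_nonisotropicRoots hL hα' hαβσ h2
  have h4 := hφ.map_add hL hα' hαβσ h2
  have h5 := hφ.map_add hL hασ hβ h1
  have e1 : -α + (α + σ + β) = β + σ := by abel
  have e2 : α + σ + β = α + β + σ := by abel
  rw [e1] at h3 h4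
  refine ⟨⟨h3, ?_⟩, ⟨e2 ▸ hαβσ, ?_⟩⟩
  · rw [h4, h5, hc]
    calc _ = φ (α₀ + σ) / φ α₀ * φ β * (φ α * φ (-α)) := by
          simp only [mul_comm, mul_left_comm, mul_assoc]
      _ = _ := by rw [hφ.mul_neg hΨ hα, mul_one]
  · rw [← e2, h5, hc, hφ.map_add hL hα hβ h, mul_assoc]

theorem exists_isTranslationCompatible (hΨ : L.IsCartanAut Ψ) (hL : L.IsSimplyLaced)
    (hrank : 1 < L.rank) :
    ∃ φ : Dual ℂ L.H → ℂˣ, L.IsEigenvalueMap Ψ φ ∧ L.IsTranslationCompatible φ := by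
  classical
  obtain ⟨φ, hφ⟩ := exists_isEigenvalueMap hΨ
  choose! c hc using fun (σ : Dual ℂ L.H) (hσ : σ ∈ L.isotropicRoots) =>
    hφ.exists_translation_factor hΨ hL hrank hσ
  -- The values of φ off R^× were arbitrary; on R⁰ they become the translation factors.
  refine ⟨fun α => if α ∈ L.nonisotropicRoots then φ α else c α, fun α hα x hx => ?_,
    fun σ hσ α hα => ⟨(hc σ hσ α hα).1, ?_⟩⟩
  · simp only [hα, if_true]
    exact hφ α hα x hx
  · have hσ' : σ ∉ L.nonisotropicRoots := fun h => h.2 hσ.2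
    simp only [hα, hσ', (hc σ hσ α hα).1, if_true, if_false]
    exact (hc σ hσ α hα).2

theorem IsTranslationCompatible.map_add (ht : L.IsTranslationCompatible φ)
    (hφ : L.IsEigenvalueMap Ψ φ) (hΨ : L.IsCartanAut Ψ) (hL : L.IsSimplyLaced)
    (hrank : 1 < L.rank) {α β : Dual ℂ L.H} (hα : α ∈ L.roots) (hβ : β ∈ L.roots)
    (h : α + β ∈ L.roots) : φ (α + β) = φ α * φ β := by
  rcases L.mem_isotropicRoots_or hα with hα | hα <;> rcases L.mem_isotropicRoots_or hβ with hβ | hβ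
  -- Two isotropic roots: γ is translated by α + β at once and in two stages.
  · obtain ⟨γ, hγ⟩ := nonisotropicRoots_nonempty hrank
    have hαβ : α + β ∈ L.isotropicRoots := by
      refine (L.mem_isotropicRoots_or h).resolve_right fun hn => hn.2 ?_
      rw [L.dualForm_add_right, hL.dualForm_eq_zero hα hn, hL.dualForm_eq_zero hβ hn, add_zero]
    have h1 := (ht _ hαβ γ hγ).2
    have h2 := ht α hα γ hγ
    rw [← add_assoc, (ht β hβ _ h2.1).2, h2.2, ← mul_assoc] at h1
    rw [← mul_right_cancel h1, mul_comm]
  · rw [add_comm]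
    exact (ht α hα β hβ).2
  · rw [(ht β hβ α hα).2, mul_comm]
  · rcases mem_isotropicRoots_or_of_add_mem hL hα hβ h with h1 | h1
    · have h2 := (ht _ h1 _ (L.neg_mem_nonisotropicRoots hα)).2
      rw [neg_add_cancel_left] at h2
      rw [h2, mul_left_comm, hφ.mul_neg hΨ hα, mul_one]
    · exact hφ.map_add hL hα hβ h1

/-- A Cartan automorphism preserves the pairing of the core with `E`. -/
theorem IsEigenvalueMap.form_map_core (hφ : L.IsEigenvalueMap Ψ φ) (hΨ : L.IsCartanAut Ψ) :
    ∀ x ∈ L.core, ∀ y : E, L.form (Ψ x) (Ψ y) = L.form x y := by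
  intro x hx
  induction hx using LieSubalgebra.lieSpan_induction with
  | mem x hx =>
    simp only [Set.mem_iUnion] at hx
    obtain ⟨α, hα, hx⟩ := hx
    refine L.rootSpace_induction (p := fun y => L.form (Ψ x) (Ψ y) = L.form x y) ?_ (by simp) ?_
    · intro β y hy
      by_cases hβ : α + β = 0
      · obtain rfl : β = -α := (neg_eq_of_add_eq_zero_right hβ).symm
        have h1 : (φ α * φ (-α) : ℂ) = 1 := by
          rw [← Units.val_mul, hφ.mul_neg hΨ hα, Units.val_one]
        rw [hφ α hα x hx, hφ _ (L.neg_mem_nonisotropicRoots hα) y hy, map_smul, map_smul,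
          LinearMap.smul_apply, smul_smul, mul_comm, h1, one_smul]
      · rw [L.form_eq_zero_of_add_ne_zero hx hy hβ, L.form_eq_zero_of_add_ne_zero
          (hΨ.map_mem_rootSpace hx) (hΨ.map_mem_rootSpace hy) hβ]
    · intro y z hy hz
      simp [hy, hz]
  | zero => simp
  | add u v _ _ hu hv => intro y; simp [hu y, hv y]
  | smul c u _ hu => intro y; simp [hu y]
  | lie u v _ _ hu hv =>
    intro y
    -- Invariance moves v into the second argument, so the hypothesis on u must hold for every y in
    -- E.
    rw [LieEquiv.map_lie, L.form_invariant, ← LieEquiv.map_lie, hu, L.form_invariant]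

/-- For e ∈ E_α, applying Ψ to [x, e] ∈ E_{α+σ} gives φ(α)[Ψx, e] = φ(σ)φ(α)[x, e], and φ(α)
cancels. -/
theorem IsTranslationCompatible.lie_core_eq_zero (ht : L.IsTranslationCompatible φ)
    (hφ : L.IsEigenvalueMap Ψ φ) {σ : Dual ℂ L.H} (hσ : σ ∈ L.isotropicRoots) {x : E}
    (hx : x ∈ L.rootSpace σ) : ∀ y ∈ L.core, ⁅Ψ x - (φ σ : ℂ) • x, y⁆ = 0 := by
  refine L.lie_core_eq_zero fun α hα e he => ?_
  obtain ⟨hασ, h1⟩ := ht σ hσ α hα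
  have h2 := hφ _ hασ _ (L.lie_mem_rootSpace hx he (add_comm _ _))
  rw [LieEquiv.map_lie, hφ α hα e he, lie_smul, h1, Units.val_mul, mul_comm, mul_smul] at h2
  rw [sub_lie, smul_lie, sub_eq_zero]
  exact smul_right_injective _ (φ α).ne_zero h2

/-- On the intersection of the core with an isotropic root space, `Ψ` acts as a scalar. -/
theorem IsTranslationCompatible.apply_core (ht : L.IsTranslationCompatible φ)
    (hφ : L.IsEigenvalueMap Ψ φ) (hΨ : L.IsCartanAut Ψ) (hL : L.IsSimplyLaced)
    (hrank : 1 < L.rank) {σ : Dual ℂ L.H} (hσ : σ ∈ L.isotropicRoots) {x : E}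
    (hx : x ∈ L.rootSpace σ) (hxc : x ∈ L.core) (hxc' : Ψ x ∈ L.core) :
    Ψ x = (φ σ : ℂ) • x := by
  have hσ' := L.neg_mem_isotropicRoots hσ
  have hmul : φ σ * φ (-σ) = 1 := by
    have h1 := ht.map_add hφ hΨ hL hrank hσ.1 hσ'.1 (by simpa using L.zero_mem_roots)
    have h2 := ht.map_add hφ hΨ hL hrank L.zero_mem_roots L.zero_mem_roots
      (by simpa using L.zero_mem_roots)
    rw [add_neg_cancel] at h1
    rw [add_zero, right_eq_mul] at h2
    rw [← h1, h2]
  have hmul' : (φ σ * φ (-σ) : ℂ) = 1 := by rw [← Units.val_mul, hmul, Units.val_one]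
  rw [← sub_eq_zero]
  refine L.eq_zero_of_form_eq_zero
    (Submodule.sub_mem _ (hΨ.map_mem_rootSpace hx) (Submodule.smul_mem _ _ hx)) fun y hy => ?_
  -- (x, y) = (Ψx, Ψy) = φ(-σ)(Ψx, y), since Ψy - φ(-σ)y is orthogonal to the core.
  have h1 := hφ.form_map_core hΨ x hxc y
  have h2 := L.form_core_eq_zero hσ'
    (Submodule.sub_mem _ (hΨ.map_mem_rootSpace hy) (Submodule.smul_mem _ _ hy))
    (ht.lie_core_eq_zero hφ hσ' hy) (Ψ x) hxc'
  rw [map_sub, map_smul, smul_eq_mul, h1] at h2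
  rw [map_sub, map_smul, LinearMap.sub_apply, LinearMap.smul_apply, smul_eq_mul]
  linear_combination (-(φ σ : ℂ)) * h2 - L.form (Ψ x) y * hmul'

end CartanAut

/-- A linear map of finite order has no non-trivial generalized eigenvectors. -/
theorem apply_eq_smul_of_iterate_eq {Ψ : E ≃ₗ⁅ℂ⁆ E} {m : ℕ} (hm : 0 < m)
    (hfin : ∀ x : E, Ψ^[m] x = x) {c : ℂ} {x z : E} (hx : Ψ x = c • x + z)
    (hz : Ψ z = c • z) : Ψ x = c • x := by
  have h1 : ∀ n : ℕ, Ψ^[n] z = c ^ n • z := by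
    intro n
    induction n with
    | zero => simp
    | succ n ih => rw [Function.iterate_succ_apply', ih, map_smul, hz, smul_smul, pow_succ]
  -- The extra factor c avoids the exponent n - 1 in the Jordan block formula.
  have h2 : ∀ n : ℕ, c • Ψ^[n] x = c ^ (n + 1) • x + (n * c ^ n) • z := by
    intro n
    induction n with
    | zero => simp
    | succ n ih =>
      rw [Function.iterate_succ_apply', ← map_smul, ih, map_add, map_smul, map_smul, hx, hz]
      push_cast
      module
  by_cases hz0 : z = 0
  · simpa [hz0] using hx
  exfalso
  have h3 : c ^ m = 1 := by
    have h := h1 m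
    rw [hfin, ← sub_eq_zero] at h
    have h' : (1 - c ^ m) • z = 0 := by rw [sub_smul, one_smul, h]
    exact (sub_eq_zero.1 ((smul_eq_zero.1 h').resolve_right hz0)).symm
  have h4 := h2 m
  rw [hfin, pow_succ, h3, one_mul, mul_one, left_eq_add, smul_eq_zero] at h4
  exact h4.elim (by exact_mod_cast hm.ne') hz0

end ExtendedAffineLieAlgebra

end
-- Uniqueness, multiplicativity and diagonality
theorem proposition4p9 {E : Type*} [LieRing E] [LieAlgebra ℂ E]
    (L : ExtendedAffineLieAlgebra E)
    (hlaced : L.IsSimplyLaced) (hrank : 1 < L.rank)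
    (Ψ : E ≃ₗ⁅ℂ⁆ E) (hΨ : L.IsCartanAut Ψ)
    (hfin : ∃ m : ℕ, 0 < m ∧ ∀ x : E, Ψ^[m] x = x) :
    L.IsDiagonal Ψ ∧
      (∃! ψ : L.roots → ℂˣ, L.IsAssociated Ψ ψ) ∧
      ∀ ψ : L.roots → ℂˣ, L.IsAssociated Ψ ψ → L.IsCharacter ψ := by
  obtain ⟨m, hm, hfin⟩ := hfin
  obtain ⟨φ, hφ, ht⟩ :=
    ExtendedAffineLieAlgebra.exists_isTranslationCompatible hΨ hlaced hrank
  have huniq : ∀ ψ : L.roots → ℂˣ, L.IsAssociated Ψ ψ → ∀ α : L.roots, ψ α = φ α := by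
    intro ψ hψ
    have hnon : ∀ α : L.roots, (α : Module.Dual ℂ L.H) ∈ L.nonisotropicRoots → ψ α = φ α := by
      intro α hα
      obtain ⟨x, hx, hx0⟩ := L.exists_ne_zero_of_mem_roots hα.1
      have h := hψ.nonisotropic α hα x hx
      rw [hφ α hα x hx] at h
      exact Units.ext (smul_left_injective ℂ hx0 h.symm)
    intro σ
    rcases L.mem_isotropicRoots_or σ.2 with hσ | hσ
    -- Every translate α + σ is a non-isotropic root, so the isotropic condition is never vacuous
    -- and forces ψ(σ).
    · obtain ⟨α, hα⟩ := ExtendedAffineLieAlgebra.nonisotropicRoots_nonempty hrank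
      have hα' := L.neg_mem_nonisotropicRoots hα
      obtain ⟨hασ, h⟩ := ht σ hσ α hα
      have h1 := hψ.isotropic σ ⟨α, hα.1⟩ ⟨α + σ, hασ.1⟩ ⟨-α, hα'.1⟩ hσ hα hασ rfl rfl
      rw [h1, hnon ⟨α + σ, hασ.1⟩ hασ, hnon ⟨-α, hα'.1⟩ hα', h, mul_assoc, hφ.mul_neg hΨ hα, mul_one]
    · exact hnon σ hσ
  have hmul : ∀ α β γ : L.roots, (γ : Module.Dual ℂ L.H) = α + β → φ γ = φ α * φ β := by
    intro α β γ h
    rw [h]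
    exact ht.map_add hφ hΨ hlaced hrank α.2 β.2 (h ▸ γ.2)
  refine ⟨fun α hα => ?_, ⟨fun α => φ α, ⟨fun α hα => hφ α hα, ?_⟩, fun ψ hψ => funext (huniq ψ hψ)⟩,
    fun ψ hψ => ?_⟩
  · refine ⟨φ α, fun x hx => ?_⟩
    rcases L.mem_isotropicRoots_or hα with hσ | hα
    · have hz := ht.lie_core_eq_zero hφ hσ hx
      have hzα := Submodule.sub_mem _ (hΨ.map_mem_rootSpace hx)
        (Submodule.smul_mem _ (φ α : ℂ) hx)
      have hz' := ht.lie_core_eq_zero hφ hσ hzα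
      have hzc := L.tame _ hz
      refine ExtendedAffineLieAlgebra.apply_eq_smul_of_iterate_eq hm hfin
        (add_sub_cancel _ _).symm (ht.apply_core hφ hΨ hlaced hrank hσ hzα hzc ?_)
      -- For the defect z of x, Ψz is in the core: Ψz - φ(α)z centralizes the core, hence lies in it
      -- by tameness, and so does z.
      rw [← sub_add_cancel (Ψ _) ((φ α : ℂ) • (Ψ x - (φ α : ℂ) • x))]
      exact add_mem (L.tame _ hz') (L.core.smul_mem _ hzc)
    · exact hφ α hα x hx
  · intro σ α β γ hσ hα hβ hβ' hγ
    rw [hβ', hγ, (ht σ hσ α hα).2, mul_assoc, hφ.mul_neg hΨ hα, mul_one]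
  · have h : ∀ α β γ : L.roots, (γ : Module.Dual ℂ L.H) = α + β → ψ γ = ψ α * ψ β := by
      intro α β γ h
      rw [huniq ψ hψ, huniq ψ hψ, huniq ψ hψ, hmul α β γ h]
    exact ⟨fun α β γ _ => h α β γ, h⟩
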